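/- All tournaments are irreflexive, antisymmetric and complete binary relations; an edge $(x,y)$ is written $x\to y$. For a tournament $T$, the age $\mathcal A(T)$ is the set of isomorphism types of the subtournaments induced by $T$ on the finite subsets of its vertex set, and the profile $\varphi_T(n)$ is the number of isomorphism types of subtournaments induced by $T$ on the $n$-element subsets of its vertex set. For an acyclic tournament $C=(A,<)$ (with edges $x\to y$ for $x<y$) define six tournaments: - $C_{3[C]}$ is the lexicographical product of the $3$-cycle $C_3$ by $C$: its vertex set is $V(C_3)\times A$, and $(p,x)\to(q,y)$ iff either $x=y$ and $p\to q$ in $C_3$, or $x<y$. - $V_{[C]}$ has vertex set $(A\times\{0,1\})\cup\{a\}$ with $a\notin A\times\{0,1\}$; $(x,i)\to(x',i')$ iff $x<x'$, or $x=x'$ and $i<i'$; moreover $a\to(x,0)$ and $(x,1)\to a$ for every $x\in A$. - $T_{[C]},U_{[C]},H_{[C]},K_{[C]}$ all have vertex set $A\times\{0,1\}$, and in each of them $(x,0)\to(x,1)$ for all $x\in A$ and $(x,0)\to(y,0)$ for all $x<y$. The remaining edges are, for all $x<y$ in $A$: - in $T_{[C]}$: $(x,1)\to(y,1)$, $(y,1)\to(x,0)$,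 $(y,0)\to(x,1)$; - in $U_{[C]}$: $(y,1)\to(x,1)$, $(x,0)\to(y,1)$, $(x,1)\to(y,0)$; - in $H_{[C]}$: $(x,1)\to(y,1)$, $(y,1)\to(x,0)$, $(x,1)\to(y,0)$; - in $K_{[C]}$: $(y,1)\to(x,1)$, $(y,1)\to(x,0)$, $(x,1)\to(y,0)$. Let $\omega=(\mathbb N,<)$, let $\omega^*$ be its dual (all edges reversed), and let $\mathfrak B$ be the set of the twelve tournaments $C_{3[C]},V_{[C]},T_{[C]},U_{[C]},H_{[C]},K_{[C]}$ with $C\in\{\omega,\omega^*\}$. Then the ages $\mathcal A(T)$, $T\in\mathfrak B$, form exactly six distinct sets, and these six sets are pairwise incomparable with respect to inclusion. Moreover, for each $T\in\mathfrak B$ there are real numbers $a>0$ and $c>1$ such that $\varphi_T(n)\ge a\,c^n$ for every integer $n\ge 0$. -/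

import Mathlib

/-- A tournament: a set of vertices with an irreflexive, antisymmetric and complete binary
relation, whose pairs are the edges. -/
structure Tournament where
  /-- The vertices. -/
  V : Type
  /-- `E x y` says that `(x, y)` is an edge. -/
  E : V → V → Prop
  irrefl : ∀ x, ¬ E x x
  antisymm : ∀ x y, E x y → E y x → x = y
  complete : ∀ x y, x ≠ y → E x y ∨ E y x

namespace Tournament

/-- The dual tournament: all edges are reversed. -/
def dual (T : Tournament) : Tournament where
  V := T.V
  E x y := T.E y x
  irrefl := T.irrefl
  antisymm x y h h' := T.antisymm x y h' h
  complete x y h := (T.complete x y h).symm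

/-- The subtournament induced on a set of vertices. -/
def restrict (T : Tournament) (A : Set T.V) : Tournament where
  V := A
  E x y := T.E x y
  irrefl x := T.irrefl x
  antisymm x y h h' := Subtype.ext (T.antisymm x y h h')
  complete x y h := T.complete x y (fun e => h (Subtype.ext e))

/-- Isomorphism of tournaments. -/
def Isomorphic (T T' : Tournament) : Prop := Nonempty (T.E ≃r T'.E)

instance isoSetoid : Setoid Tournament where
  r := Isomorphic
  iseqv :=
    ⟨fun T => ⟨RelIso.refl T.E⟩, fun ⟨e⟩ => ⟨e.symm⟩, fun ⟨e⟩ ⟨f⟩ => ⟨e.trans f⟩⟩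

/-- Isomorphism types of tournaments. -/
def IsoType : Type 1 := Quotient isoSetoid

/-- The isomorphism type of a tournament. -/
def isoType (T : Tournament) : IsoType := Quotient.mk isoSetoid T

/-- The age of `T`: the set of isomorphism types of the subtournaments induced by `T` on the
finite sets of vertices. -/
def age (T : Tournament) : Set IsoType :=
  {t | ∃ A : Finset T.V, (T.restrict (A : Set T.V)).isoType = t}

/-- The profile of `T`: the number of subtournaments induced by `T` on the `n`-element sets of
vertices, isomorphic tournaments being identified. -/
noncomputable def profile (T : Tournament) (n : ℕ) : ℕ :=
  {t | ∃ A : Finset T.V, A.card = n ∧ (T.restrict (A : Set T.V)).isoType = t}.ncard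

/-- The tournament `ω`: the natural numbers with their strict order. -/
def omega : Tournament where
  V := ℕ
  E x y := x < y
  irrefl x := lt_irrefl x
  antisymm _ _ h h' := absurd h (lt_asymm h')
  complete _ _ h := lt_or_gt_of_ne h

/-- The 3-cycle `0 → 1 → 2 → 0`. -/
def C3 : Tournament where
  V := Fin 3
  E x y := y = x + 1
  irrefl := by decide
  antisymm := by decide
  complete := by decide

/-- The lexicographical product `T.D`: every vertex of `D` is replaced by a copy of `T`. -/
def lexProd (T D : Tournament) : Tournament where
  V := T.V × D.V
  E p q := (p.2 = q.2 ∧ T.E p.1 q.1) ∨ D.E p.2 q.2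
  irrefl p := by
    rintro (⟨-, h⟩ | h)
    · exact T.irrefl _ h
    · exact D.irrefl _ h
  antisymm p q := by
    rintro (⟨e, h⟩ | h) (⟨e', h'⟩ | h')
    · exact Prod.ext (T.antisymm _ _ h h') e
    · rw [e] at h'; exact absurd h' (D.irrefl _)
    · rw [e'] at h; exact absurd h (D.irrefl _)
    · have e := D.antisymm _ _ h h'
      rw [e] at h; exact absurd h (D.irrefl _)
  complete p q hpq := by
    by_cases e : p.2 = q.2
    · rcases T.complete p.1 q.1 (fun e' => hpq (Prod.ext e' e)) with h | h
      · exact Or.inl (Or.inl ⟨e, h⟩)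
      · exact Or.inr (Or.inl ⟨e.symm, h⟩)
    · rcases D.complete _ _ e with h | h
      · exact Or.inl (Or.inr h)
      · exact Or.inr (Or.inr h)

/-- The tournament `C_{3[C]} = C₃.C`. -/
def C3Of (C : Tournament) : Tournament := lexProd C3 C

/-- The edges of `V_{[C]}`; the additional vertex `a` is `none`. -/
def VRel (C : Tournament) : Option (C.V × Fin 2) → Option (C.V × Fin 2) → Prop
  | some (x, i), some (x', i') => C.E x x' ∨ (x = x' ∧ i < i')
  | none, some (_, i') => i' = 0
  | some (_, i), none => i = 1
  | none, none => False

/-- The tournament `V_{[C]}`. -/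
def VOf (C : Tournament) : Tournament where
  V := Option (C.V × Fin 2)
  E := VRel C
  irrefl := by
    rintro (_ | ⟨x, i⟩)
    · exact id
    · rintro (h | ⟨-, h⟩)
      · exact C.irrefl _ h
      · exact lt_irrefl _ h
  antisymm := by
    rintro (_ | ⟨x, i⟩) (_ | ⟨y, j⟩) h h'
    · rfl
    · simp only [VRel] at h h'; omega
    · simp only [VRel] at h h'; omega
    · rcases h with h | ⟨e, h⟩ <;> rcases h' with h' | ⟨e', h'⟩
      · have e := C.antisymm _ _ h h'
        subst e; exact absurd h (C.irrefl _)
      · subst e'; exact absurd h (C.irrefl _)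
      · subst e; exact absurd h' (C.irrefl _)
      · exact absurd h (lt_asymm h')
  complete := by
    rintro (_ | ⟨x, i⟩) (_ | ⟨y, j⟩) h
    · exact absurd rfl h
    · simp only [VRel]; omega
    · simp only [VRel]; omega
    · by_cases e : x = y
      · subst e
        have hij : i ≠ j := fun e => h (by rw [e])
        rcases lt_or_gt_of_ne hij with h | h
        · exact Or.inl (Or.inr ⟨rfl, h⟩)
        · exact Or.inr (Or.inr ⟨rfl, h⟩)
      · rcases C.complete _ _ e with h | h
        · exact Or.inl (Or.inl h)
        · exact Or.inr (Or.inl h)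

/-- Ordered pairs of elements of `{0,1} × {0,1}`. -/
abbrev Arc : Type := (Fin 2 × Fin 2) × (Fin 2 × Fin 2)

/-- `h_i = ((0,i),(1,i))`. -/
def hArc (i : Fin 2) : Arc := ((0, i), (1, i))

/-- `v_i = ((i,0),(i,1))`. -/
def vArc (i : Fin 2) : Arc := ((i, 0), (i, 1))

/-- `d_i = ((0,i),(1,i+1))`, with `i + 1` taken modulo 2. -/
def dArc (i : Fin 2) : Arc := ((0, i), (1, i + 1))

/-- The edges of the directed graph `Δ(C,X)` on `V(C) × {0,1}`. -/
def DeltaRel (C : Tournament) (X : Finset Arc) (e f : C.V × Fin 2) : Prop :=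
  (e.1 = f.1 ∧ ((0, e.2), (0, f.2)) ∈ X) ∨
  (C.E e.1 f.1 ∧ ((0, e.2), (1, f.2)) ∈ X) ∨
  (C.E f.1 e.1 ∧ ((1, e.2), (0, f.2)) ∈ X)

/-- The condition on `X` under which `Δ(C,X)` is a tournament for every tournament `C`. -/
def Good (X : Finset Arc) : Prop :=
  (∀ i j : Fin 2, ((0, i), (0, j)) ∈ X → ((0, j), (0, i)) ∉ X) ∧
  (∀ i j : Fin 2, i ≠ j → ((0, i), (0, j)) ∈ X ∨ ((0, j), (0, i)) ∈ X) ∧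
  (∀ i j : Fin 2, ((0, i), (1, j)) ∈ X → ((1, j), (0, i)) ∉ X) ∧
  (∀ i j : Fin 2, ((0, i), (1, j)) ∈ X ∨ ((1, j), (0, i)) ∈ X)

/-- `Δ(C,X)` as a tournament. -/
def Delta (C : Tournament) (X : Finset Arc) (hX : Good X) : Tournament where
  V := C.V × Fin 2
  E := DeltaRel C X
  irrefl := by
    rintro ⟨x, i⟩ (⟨-, h⟩ | ⟨h, -⟩ | ⟨h, -⟩)
    · exact hX.1 i i h h
    · exact C.irrefl _ h
    · exact C.irrefl _ h
  antisymm := by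
    have hC : ∀ x y, C.E x y → ¬ C.E y x := fun x y h h' => by
      have e := C.antisymm _ _ h h'
      subst e; exact C.irrefl _ h
    rintro ⟨x, i⟩ ⟨y, j⟩ h h'
    exfalso
    simp only [DeltaRel] at h h'
    by_cases e : x = y
    · subst e
      have h1 := hX.1 i j
      have h2 := C.irrefl x
      tauto
    · have h1 := hC x y
      have h2 := hX.2.2.1 i j
      have h3 := hX.2.2.1 j i
      have e' : y ≠ x := fun h => e h.symm
      tauto
  complete := by
    rintro ⟨x, i⟩ ⟨y, j⟩ h
    simp only [DeltaRel]
    by_cases e : x = y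
    · subst e
      have h1 := hX.2.1 i j (fun e => h (by rw [e]))
      tauto
    · have h1 := C.complete x y e
      have h2 := hX.2.2.2 i j
      have h3 := hX.2.2.2 j i
      tauto

/-- The tournament `T_{[C]}`. -/
def TOf (C : Tournament) : Tournament :=
  Delta C {(dArc 0).swap, (dArc 1).swap, hArc 1, hArc 0, vArc 0} (by refine ⟨?_, ?_, ?_, ?_⟩ <;> decide)

/-- The tournament `U_{[C]}`. -/
def UOf (C : Tournament) : Tournament :=
  Delta C {dArc 0, dArc 1, (hArc 1).swap, hArc 0, vArc 0} (by refine ⟨?_, ?_, ?_, ?_⟩ <;> decide)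

/-- The tournament `H_{[C]}`. -/
def HOf (C : Tournament) : Tournament :=
  Delta C {(dArc 0).swap, dArc 1, hArc 1, hArc 0, vArc 0} (by refine ⟨?_, ?_, ?_, ?_⟩ <;> decide)

/-- The tournament `K_{[C]}`. -/
def KOf (C : Tournament) : Tournament :=
  Delta C {(dArc 0).swap, dArc 1, (hArc 1).swap, hArc 0, vArc 0} (by refine ⟨?_, ?_, ?_, ?_⟩ <;> decide)

/-- The set `𝔅_C` of the six tournaments built from `C`. -/
def frakBOf (C : Tournament) : Set Tournament :=
  {C3Of C, VOf C, TOf C, UOf C, HOf C, KOf C}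

/-- The set `𝔅 = 𝔅_ω ∪ 𝔅_{ω*}`. -/
def frakB : Set Tournament := frakBOf omega ∪ frakBOf omega.dual

end Tournament

/-!
Every construction is monotone in the age of `C`, and `ω` and `ω*` have the same age, so only the
six tournaments over `ω` matter. Given two of them, some small pattern embeds in the first and not
in the second, because of the following obstructions:

* in `C₃[ω]`, a 3-cycle is determined by two of its vertices, since it projects to a point of `ω`;
* in `V[ω]`, all 3-cycles pass through the vertex `a`;
* in `T[ω]`, no vertex dominates a 3-cycle;
* in `U[ω]`, `H[ω]` and `K[ω]`, the second coordinate is a 2-colouring. In `U[ω]`, every 3-cycle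
  has exactly two vertices of colour `1`, and every path with colours `1`, `0`, `1` closes to a
  3-cycle. In `H[ω]` and `K[ω]`, no 3-cycle is monochromatic, and the edges from colour `0` to
  colour `1` join the two vertices over a point of `ω`, so that the order of these points determines
  the edge between the origins of two of them, and the edge between their ends.

For the growth, take the first `p` positions of a chain and choose optional vertices over `m` of
them. An isomorphism between two such subtournaments which fixes one suitable vertex preserves the
order of the positions, hence fixes all of them and preserves the choice. So at most `n` choices,
`n` being the number of vertices, give isomorphic subtournaments, and `n φ(n) ≥ p.choose m ≥ 2 ^ m`
as soon as `p ≥ 2 m`. This is exponential for `m = ⌊(n - 1) / 4⌋`.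
-/

namespace Tournament

open Finset

variable {S T T' C C' : Tournament}

section Embeddings

instance : Std.Asymm T.E where
  asymm x y h h' := by
    obtain rfl := T.antisymm x y h h'
    exact T.irrefl x h

instance : Std.Trichotomous T.E where
  trichotomous x y h h' := by
    by_contra hne
    exact (T.complete x y hne).elim h h'

theorem isoType_mem_age_iff : S.isoType ∈ T.age ↔ Finite S.V ∧ Nonempty (S.E ↪r T.E) := by
  constructor
  · rintro ⟨A, hA⟩
    obtain ⟨e⟩ := Quotient.exact hA
    exact ⟨Finite.of_equiv (A : Set T.V) e.toEquiv,
      ⟨e.symm.toRelEmbedding.trans (Subtype.relEmbedding T.E _)⟩⟩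
  · rintro ⟨hS, ⟨f⟩⟩
    refine ⟨(Set.finite_range f).toFinset, Quotient.sound ⟨RelIso.symm ?_⟩⟩
    rw [Set.Finite.coe_toFinset]
    exact ⟨Equiv.ofInjective f f.injective, f.map_rel_iff⟩

theorem age_subset_age_iff :
    T.age ⊆ T'.age ↔ ∀ A : Finset T.V, Nonempty ((T.restrict (A : Set T.V)).E ↪r T'.E) := by
  constructor
  · exact fun h A => (isoType_mem_age_iff.1 (h ⟨A, rfl⟩)).2
  · rintro h _ ⟨A, rfl⟩
    exact isoType_mem_age_iff.2 ⟨A.finite_toSet, h A⟩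

theorem age_lexProd_mono (D : Tournament) (h : C.age ⊆ C'.age) :
    (lexProd D C).age ⊆ (lexProd D C').age := by
  classical
  refine age_subset_age_iff.2 fun (A : Finset (D.V × C.V)) => ?_
  obtain ⟨g⟩ := age_subset_age_iff.1 h (A.image Prod.snd)
  refine ⟨RelEmbedding.ofMonotone
    (fun p => (p.1.1, g ⟨p.1.2, mem_coe.2 (mem_image_of_mem _ p.2)⟩)) ?_⟩
  rintro ⟨⟨i, x⟩, hp⟩ ⟨⟨j, y⟩, hq⟩ (⟨rfl, hE⟩ | hE)
  · exact .inl ⟨rfl, hE⟩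
  · exact .inr (g.map_rel_iff.2 hE)

theorem age_VOf_mono (h : C.age ⊆ C'.age) : (VOf C).age ⊆ (VOf C').age := by
  classical
  refine age_subset_age_iff.2 fun (A : Finset (Option (C.V × Fin 2))) => ?_
  obtain ⟨g⟩ := age_subset_age_iff.1 h (A.eraseNone.image Prod.fst)
  have mem {p : C.V × Fin 2} (hp : some p ∈ A) : p.1 ∈ A.eraseNone.image Prod.fst :=
    mem_image_of_mem _ (mem_eraseNone.2 hp)
  refine ⟨RelEmbedding.ofMonotone (fun
    | ⟨none, _⟩ => none
    | ⟨some p, hp⟩ => some (g ⟨p.1, mem hp⟩, p.2)) ?_⟩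
  rintro ⟨_ | ⟨x, i⟩, hp⟩ ⟨_ | ⟨y, j⟩, hq⟩ hE
  · exact hE
  · exact hE
  · exact hE
  · obtain hE | ⟨rfl, hij⟩ := hE
    · exact .inl (g.map_rel_iff.2 hE)
    · exact .inr ⟨rfl, hij⟩

theorem age_Delta_mono (X : Finset Arc) (hX : Good X) (h : C.age ⊆ C'.age) :
    (Delta C X hX).age ⊆ (Delta C' X hX).age := by
  classical
  refine age_subset_age_iff.2 fun (A : Finset (C.V × Fin 2)) => ?_
  obtain ⟨g⟩ := age_subset_age_iff.1 h (A.image Prod.fst)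
  refine ⟨RelEmbedding.ofMonotone
    (fun p => (g ⟨p.1.1, mem_coe.2 (mem_image_of_mem _ p.2)⟩, p.1.2)) ?_⟩
  rintro ⟨⟨x, i⟩, hp⟩ ⟨⟨y, j⟩, hq⟩ (⟨rfl, hX⟩ | ⟨hE, hX⟩ | ⟨hE, hX⟩)
  · exact .inl ⟨rfl, hX⟩
  · exact .inr (.inl ⟨g.map_rel_iff.2 hE, hX⟩)
  · exact .inr (.inr ⟨g.map_rel_iff.2 hE, hX⟩)

theorem age_omega_dual : omega.dual.age = omega.age := by
  let reverse (A : Finset ℕ) (x : ℕ) : ℕ := A.sup id - x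
  have reverse_lt {A : Finset ℕ} {x y : ℕ} (hy : y ∈ A) (hxy : x < y) :
      reverse A y < reverse A x :=
    Nat.sub_lt_sub_left (hxy.trans_le (le_sup (f := id) hy)) hxy
  apply Set.Subset.antisymm <;> refine age_subset_age_iff.2 fun (A : Finset ℕ) => ?_
  · exact ⟨RelEmbedding.ofMonotone (reverse A ∘ Subtype.val) fun x _ h => reverse_lt x.2 h⟩
  · exact ⟨RelEmbedding.ofMonotone (reverse A ∘ Subtype.val) fun _ y h => reverse_lt y.2 h⟩

end Embeddings

section Profile

/-- The level `n` of the age of `T`, i.e. the set of types counted by `T.profile n`. -/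
def ageOfCard (T : Tournament) (n : ℕ) : Set IsoType :=
  {t | ∃ A : Finset T.V, #A = n ∧ (T.restrict (A : Set T.V)).isoType = t}

theorem finite_ageOfCard (T : Tournament) (n : ℕ) : (T.ageOfCard n).Finite := by
  choose A hcard hA using fun t : T.ageOfCard n => t.2
  let e (t) : A t ≃ Fin n := (A t).equivFinOfCardEq (hcard t)
  refine Finite.of_injective (β := Fin n → Fin n → Prop)
    (fun t i j => T.E ((e t).symm i) ((e t).symm j)) fun t t' h => Subtype.ext ?_
  rw [← hA t, ← hA t']
  refine Quotient.sound ⟨⟨(e t).trans (e t').symm, fun {x y : A t} => ?_⟩⟩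
  have hxy := congrFun₂ h (e t x) (e t y)
  simp only [Equiv.symm_apply_apply] at hxy
  exact hxy.symm.to_iff

theorem one_le_profile_zero (T : Tournament) : 1 ≤ T.profile 0 :=
  (Set.ncard_pos (T.finite_ageOfCard 0)).2 ⟨_, ∅, rfl, rfl⟩

theorem ageOfCard_mono (h : T.age ⊆ T'.age) (n : ℕ) : T.ageOfCard n ⊆ T'.ageOfCard n := by
  rintro _ ⟨A, hA, rfl⟩
  obtain ⟨B, hB⟩ := h ⟨A, rfl⟩
  obtain ⟨e⟩ := Quotient.exact hB
  exact ⟨B, (card_eq_of_equiv e.toEquiv).trans hA, hB⟩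

theorem profile_mono (h : T.age ⊆ T'.age) (n : ℕ) : T.profile n ≤ T'.profile n :=
  Set.ncard_le_ncard (ageOfCard_mono h n) (T'.finite_ageOfCard n)

/-- `T.IsIsoOn f A B` says that `f` induces an isomorphism from the subtournament of `T` induced
on `A` to the one induced on `B`; the values of `f` outside `A` are irrelevant. -/
def IsIsoOn (T : Tournament) (f : T.V → T.V) (A B : Finset T.V) : Prop :=
  Set.BijOn f A B ∧ ∀ x ∈ A, ∀ y ∈ A, T.E (f x) (f y) ↔ T.E x y

theorem exists_isIsoOn_of_equiv {A B : Finset T.V} (e : A ≃ B)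
    (he : ∀ x y, T.E (e x) (e y) ↔ T.E x y) : ∃ f, T.IsIsoOn f A B ∧ ∀ x : A, f x = e x := by
  let f : T.V → T.V := Function.extend Subtype.val (fun x => (e x : T.V)) id
  have hf (x : A) : f x = e x := Subtype.val_injective.extend_apply _ _ x
  refine ⟨f, ⟨⟨fun x hx => ?_, fun x hx y hy hxy => ?_, fun y hy => ?_⟩, fun x hx y hy => ?_⟩, hf⟩
  · rw [hf ⟨x, hx⟩]
    exact (e ⟨x, hx⟩).2
  · rw [hf ⟨x, hx⟩, hf ⟨y, hy⟩] at hxy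
    exact congrArg Subtype.val (e.injective (Subtype.ext hxy))
  · exact ⟨e.symm ⟨y, hy⟩, (e.symm ⟨y, hy⟩).2, by rw [hf, e.apply_symm_apply]⟩
  · rw [hf ⟨x, hx⟩, hf ⟨y, hy⟩, he]

theorem card_le_of_isoType_eq {ι : Type*} (a : T.V) (s : Finset ι) (A : ι → Finset T.V)
    (B : Finset T.V) (ha : ∀ i ∈ s, a ∈ A i)
    (iso : ∀ i ∈ s, (T.restrict (A i : Set T.V)).isoType = (T.restrict (B : Set T.V)).isoType)
    (rigid : ∀ i ∈ s, ∀ j ∈ s, ∀ f, T.IsIsoOn f (A i) (A j) → f a = a → i = j) : #s ≤ #B := by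
  have exists_equiv (i : s) : ∃ e : A i ≃ B, ∀ x y, T.E (e x) (e y) ↔ T.E x y := by
    obtain ⟨e⟩ := Quotient.exact (iso i i.2)
    exact ⟨e.toEquiv, fun _ _ => e.map_rel_iff⟩
  choose e he using exists_equiv
  refine card_le_card_of_injective (f := fun i : s => e i ⟨a, ha i i.2⟩) fun i j hij =>
    Subtype.ext ?_
  obtain ⟨f, hf, hfe⟩ := exists_isIsoOn_of_equiv ((e i).trans (e j).symm) fun x y => by
    rw [← he i, ← he j, Equiv.trans_apply, Equiv.trans_apply, Equiv.apply_symm_apply,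
      Equiv.apply_symm_apply]
  refine rigid i i.2 j j.2 f hf ((hfe ⟨a, ha i i.2⟩).trans ?_)
  exact congrArg Subtype.val ((e j).symm_apply_eq.2 hij)

theorem card_le_mul_profile {ι : Type*} {n : ℕ} (a : T.V) (s : Finset ι) (A : ι → Finset T.V)
    (ha : ∀ i ∈ s, a ∈ A i) (hcard : ∀ i ∈ s, #(A i) = n)
    (rigid : ∀ i ∈ s, ∀ j ∈ s, ∀ f, T.IsIsoOn f (A i) (A j) → f a = a → i = j) :
    #s ≤ n * T.profile n := by
  classical
  let type (i : ι) : IsoType := (T.restrict (A i : Set T.V)).isoType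
  have fiber : ∀ t ∈ s.image type, #{i ∈ s | type i = t} ≤ n := by
    intro t ht
    obtain ⟨j, hj, rfl⟩ := mem_image.1 ht
    have mem {i} (hi : i ∈ {i ∈ s | type i = type j}) : i ∈ s := (mem_filter.1 hi).1
    exact (card_le_of_isoType_eq a _ A (A j) (fun i hi => ha i (mem hi))
      (fun i hi => (mem_filter.1 hi).2) fun i hi k hk => rigid i (mem hi) k (mem hk)).trans_eq
      (hcard j hj)
  refine (card_le_mul_card_image s n fiber).trans (Nat.mul_le_mul_left _ ?_)
  rw [← Set.ncard_coe_finset]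
  refine Set.ncard_le_ncard (fun t ht => ?_) (T.finite_ageOfCard n)
  obtain ⟨i, hi, rfl⟩ := mem_image.1 (mem_coe.1 ht)
  exact ⟨A i, hcard i hi, rfl⟩

end Profile

section ExponentialGrowth

theorem two_pow_le_centralBinom (m : ℕ) : 2 ^ m ≤ m.centralBinom := by
  induction m with
  | zero => simp
  | succ m ih =>
    refine Nat.le_of_mul_le_mul_left ?_ m.succ_pos
    calc (m + 1) * 2 ^ (m + 1) = 2 * (m + 1) * 2 ^ m := by ring
      _ ≤ 2 * (2 * m + 1) * m.centralBinom := by gcongr; lia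
      _ = (m + 1) * (m + 1).centralBinom := m.succ_mul_centralBinom_succ.symm

theorem two_pow_le_choose {m p : ℕ} (h : 2 * m ≤ p) : 2 ^ m ≤ p.choose m :=
  (two_pow_le_centralBinom m).trans (Nat.choose_le_choose m h)

-- The factor `n` is absorbed by Bernoulli's inequality, at the price of a smaller base.
theorem exists_exponential_lower_bound {f : ℕ → ℕ} (h0 : 1 ≤ f 0)
    (h : ∀ n, 1 ≤ n → 2 ^ ((n - 1) / 4) ≤ n * f n) :
    ∃ a c : ℝ, 0 < a ∧ 1 < c ∧ ∀ n : ℕ, a * c ^ n ≤ (f n : ℝ) := by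
  refine ⟨1 / 40, 21 / 20, by norm_num, by norm_num, fun n => ?_⟩
  obtain rfl | hn := n.eq_zero_or_pos
  · have : (1 : ℝ) ≤ f 0 := by exact_mod_cast h0
    norm_num
    linarith
  have hn' : (0 : ℝ) < n := by exact_mod_cast hn
  have lower : (2 : ℝ) ^ ((n - 1) / 4) ≤ n * f n := by exact_mod_cast h n hn
  have square : (21 / 20 : ℝ) ^ n * (21 / 20) ^ n ≤ 2 * (n * f n) := calc
    (21 / 20 : ℝ) ^ n * (21 / 20) ^ n = (21 / 20) ^ (n + n) := (pow_add _ _ _).symm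
    _ ≤ (21 / 20) ^ (8 * ((n - 1) / 4 + 1)) := pow_le_pow_right₀ (by norm_num) (by lia)
    _ = ((21 / 20) ^ 8) ^ ((n - 1) / 4 + 1) := pow_mul _ _ _
    _ ≤ 2 ^ ((n - 1) / 4 + 1) := by gcongr; norm_num
    _ = 2 * 2 ^ ((n - 1) / 4) := pow_succ' _ _
    _ ≤ 2 * (n * f n) := by gcongr
  have bernoulli : (n : ℝ) / 20 ≤ (21 / 20) ^ n := by
    have := one_add_mul_le_pow (a := (1 / 20 : ℝ)) (by norm_num) n
    norm_num at this
    linarith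
  have product : (n : ℝ) / 20 * (21 / 20) ^ n ≤ 2 * (n * f n) := by
    refine le_trans ?_ square
    gcongr
  refine le_of_mul_le_mul_left ?_ hn'
  linarith

end ExponentialGrowth

/-- A configuration whose finite pieces are rigid: a chain `z 0 → z 1 → ⋯`, a pivot that
dominates it, and vertices `o i` dominating the pivot such that `o i` is recognised, among all
the `o j`, by its edges with the chain. -/
structure PivotedChain (T : Tournament) where
  /-- The chain. -/
  z : ℕ → T.V
  /-- The optional vertices, one for every position in the chain. -/
  o : ℕ → T.V
  /-- The pivot. -/
  a : T.V
  z_z : ∀ ⦃i j⦄, i < j → T.E (z i) (z j)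
  a_z : ∀ i, T.E a (z i)
  o_a : ∀ i, T.E (o i) a
  z_o : ∀ i, T.E (z i) (o i)
  eq_of_z_o : ∀ ⦃i j⦄, T.E (z i) (o j) → T.E (z j) (o i) → i = j

namespace PivotedChain

variable (P : PivotedChain T) {p : ℕ} {Y Y' : Finset ℕ}

theorem z_z_iff {i j : ℕ} : T.E (P.z i) (P.z j) ↔ i < j := by
  refine ⟨fun h => ?_, fun h => P.z_z h⟩
  by_contra! hji
  obtain rfl | hji := hji.eq_or_lt
  · exact T.irrefl _ h
  · exact asymm h (P.z_z hji)

theorem z_injective : Function.Injective P.z :=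
  injective_of_increasing (· < ·) T.E P.z fun h => P.z_z h

theorem o_injective : Function.Injective P.o := fun i j h =>
  P.eq_of_z_o (h ▸ P.z_o i) (h ▸ P.z_o j)

theorem z_ne_o (i j : ℕ) : P.z i ≠ P.o j := fun h => asymm (P.a_z i) (h ▸ P.o_a j)

open Classical in
/-- The pivot, the first `p` vertices of the chain, and the optional vertices at `Y`. -/
noncomputable def vertices (p : ℕ) (Y : Finset ℕ) : Finset T.V :=
  insert P.a ((range p).image P.z ∪ Y.image P.o)

theorem mem_vertices {x : T.V} :
    x ∈ P.vertices p Y ↔ x = P.a ∨ (∃ i < p, P.z i = x) ∨ ∃ y ∈ Y, P.o y = x := by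
  simp [vertices]

theorem a_mem_vertices : P.a ∈ P.vertices p Y := P.mem_vertices.2 (.inl rfl)

theorem z_mem_vertices {i : ℕ} (hi : i < p) : P.z i ∈ P.vertices p Y :=
  P.mem_vertices.2 (.inr (.inl ⟨i, hi, rfl⟩))

theorem o_mem_vertices {y : ℕ} (hy : y ∈ Y) : P.o y ∈ P.vertices p Y :=
  P.mem_vertices.2 (.inr (.inr ⟨y, hy, rfl⟩))

theorem exists_z_of_a_edge {x : T.V} (hx : x ∈ P.vertices p Y) (h : T.E P.a x) :
    ∃ i < p, P.z i = x := by
  obtain rfl | hz | ⟨y, -, rfl⟩ := P.mem_vertices.1 hx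
  · exact absurd h (T.irrefl _)
  · exact hz
  · exact absurd h (asymm (P.o_a y))

theorem exists_o_of_edge_a {x : T.V} (hx : x ∈ P.vertices p Y) (h : T.E x P.a) :
    ∃ y ∈ Y, P.o y = x := by
  obtain rfl | ⟨i, -, rfl⟩ | ho := P.mem_vertices.1 hx
  · exact absurd h (T.irrefl _)
  · exact absurd h (asymm (P.a_z i))
  · exact ho

theorem card_vertices : #(P.vertices p Y) = p + #Y + 1 := by
  classical
  rw [vertices, card_insert_of_notMem, card_union_of_disjoint,
    card_image_of_injective _ P.z_injective, card_image_of_injective _ P.o_injective, card_range]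
  · simp only [disjoint_left, mem_image]
    rintro _ ⟨i, -, rfl⟩ ⟨y, -, h⟩
    exact P.z_ne_o i y h.symm
  · simp only [mem_union, mem_image, not_or, not_exists, not_and]
    exact ⟨fun i _ h => T.irrefl _ (h ▸ P.a_z i), fun y _ h => T.irrefl _ (h ▸ P.o_a y)⟩

section Rigidity

variable {f : T.V → T.V} (hf : T.IsIsoOn f (P.vertices p Y) (P.vertices p Y')) (hfa : f P.a = P.a)

include hf hfa

theorem map_z_eq_z {i : ℕ} (hi : i < p) : f (P.z i) = P.z i := by
  have exists_z (i : Fin p) : ∃ j : Fin p, P.z j = f (P.z i) := by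
    have edge : T.E P.a (f (P.z i)) :=
      hfa ▸ (hf.2 _ P.a_mem_vertices _ (P.z_mem_vertices i.2)).2 (P.a_z i)
    obtain ⟨j, hj, h⟩ := P.exists_z_of_a_edge (hf.1.mapsTo (P.z_mem_vertices i.2)) edge
    exact ⟨⟨j, hj⟩, h⟩
  choose g hg using exists_z
  have strictMono : StrictMono g := fun i j hij => by
    have edge := (hf.2 _ (P.z_mem_vertices i.2) _ (P.z_mem_vertices j.2)).2 (P.z_z hij)
    rw [← hg, ← hg] at edge
    exact P.z_z_iff.1 edge
  have g_eq : g ⟨i, hi⟩ = ⟨i, hi⟩ := le_antisymm strictMono.apply_le strictMono.le_apply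
  rw [← hg ⟨i, hi⟩, g_eq]

theorem subset_of_isIsoOn (hY : Y ⊆ range p) (hY' : Y' ⊆ range p) : Y ⊆ Y' := by
  intro y hy
  have edge_a := (hf.2 _ (P.o_mem_vertices hy) _ P.a_mem_vertices).2 (P.o_a y)
  rw [hfa] at edge_a
  obtain ⟨y', hy', h⟩ := P.exists_o_of_edge_a (hf.1.mapsTo (P.o_mem_vertices hy)) edge_a
  have z_o_iff {i : ℕ} (hi : i < p) : T.E (P.z i) (P.o y') ↔ T.E (P.z i) (P.o y) := by
    rw [h, ← hf.2 _ (P.z_mem_vertices hi) _ (P.o_mem_vertices hy), P.map_z_eq_z hf hfa hi]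
  have : y = y' := P.eq_of_z_o ((z_o_iff (mem_range.1 (hY hy))).2 (P.z_o y))
    ((z_o_iff (mem_range.1 (hY' hy'))).1 (P.z_o y'))
  rwa [this]

end Rigidity

theorem two_pow_le_mul_profile (P : PivotedChain T) {m p : ℕ} (h : 2 * m ≤ p) :
    2 ^ m ≤ (p + m + 1) * T.profile (p + m + 1) := by
  have count := card_le_mul_profile P.a (powersetCard m (range p)) (P.vertices p)
    (n := p + m + 1) (fun _ _ => P.a_mem_vertices)
    (fun Y hY => by rw [P.card_vertices, (mem_powersetCard.1 hY).2])
    fun Y hY Y' hY' f hf hfa => by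
      rw [mem_powersetCard] at hY hY'
      exact eq_of_subset_of_card_le (P.subset_of_isIsoOn hf hfa hY.1 hY'.1)
        (hY'.2.trans hY.2.symm).le
  rw [card_powersetCard, card_range] at count
  exact (two_pow_le_choose h).trans count

theorem two_pow_div_four_le_mul_profile (P : PivotedChain T) {n : ℕ} (hn : 1 ≤ n) :
    2 ^ ((n - 1) / 4) ≤ n * T.profile n := by
  obtain ⟨p, hp, h⟩ : ∃ p, n = p + (n - 1) / 4 + 1 ∧ 2 * ((n - 1) / 4) ≤ p :=
    ⟨n - 1 - (n - 1) / 4, by lia, by lia⟩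
  simpa only [← hp] using P.two_pow_le_mul_profile h

end PivotedChain

/-- The chain `(0, 0) → (1, 0) → ⋯` of `VOf omega`, with the additional vertex as pivot. -/
def VOf.pivotedChain : PivotedChain (VOf omega) where
  z i := some (i, 0)
  o i := some (i, 1)
  a := none
  z_z _ _ h := .inl h
  a_z _ := rfl
  o_a _ := rfl
  z_o _ := .inr ⟨rfl, zero_lt_one⟩
  eq_of_z_o i j h h' := by
    simp only [VOf, VRel, omega] at h h'
    lia

/-- The chain `(1, 0) → (2, 0) → ⋯` of `Δ(ω,X)`, with pivot `(0, k)`. -/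
def Delta.pivotedChain {X : Finset Arc} (hX : Good X) (k : Fin 2)
    (h : hArc 0 ∈ X ∧ vArc 0 ∈ X ∧ ((0, k), (1, 0)) ∈ X ∧ ((1, 1), (0, k)) ∈ X ∧
      (dArc 0 ∈ X → ((1, 0), (0, 1)) ∉ X)) : PivotedChain (Delta omega X hX) where
  z i := ((i + 1 : ℕ), 0)
  o i := ((i + 1 : ℕ), 1)
  a := ((0 : ℕ), k)
  z_z _ _ hij := .inr (.inl ⟨Nat.succ_lt_succ hij, h.1⟩)
  a_z i := .inr (.inl ⟨i.succ_pos, h.2.2.1⟩)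
  o_a i := .inr (.inr ⟨i.succ_pos, h.2.2.2.1⟩)
  z_o _ := .inl ⟨rfl, h.2.1⟩
  eq_of_z_o i j hij hji := by
    simp only [Delta, DeltaRel, omega] at hij hji
    have separated := h.2.2.2.2
    simp only [dArc] at separated
    obtain hlt | heq | hgt := lt_trichotomy i j
    · grind
    · exact heq
    · grind

/-- The edges `x → y → z → x` form a 3-cycle of the relation `r`. -/
def IsThreeCycle {α : Type*} (r : α → α → Prop) (x y z : α) : Prop := r x y ∧ r y z ∧ r z x

theorem IsThreeCycle.map {α β : Type*} {r : α → α → Prop} {s : β → β → Prop} {x y z : α}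
    (h : IsThreeCycle r x y z) (f : r ↪r s) : IsThreeCycle s (f x) (f y) (f z) :=
  ⟨f.map_rel_iff.2 h.1, f.map_rel_iff.2 h.2.1, f.map_rel_iff.2 h.2.2⟩

instance {α : Type*} (r : α → α → Prop) [DecidableRel r] (x y z : α) :
    Decidable (IsThreeCycle r x y z) :=
  inferInstanceAs (Decidable (_ ∧ _))

namespace C3Of

theorem edge_iff {x y : Fin 3 × ℕ} :
    (C3Of omega).E x y ↔ x.2 = y.2 ∧ y.1 = x.1 + 1 ∨ x.2 < y.2 :=
  Iff.rfl

theorem snd_le_of_edge {x y : Fin 3 × ℕ} (h : (C3Of omega).E x y) : x.2 ≤ y.2 := by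
  obtain ⟨h, -⟩ | h := edge_iff.1 h
  exacts [h.le, h.le]

theorem snd_eq_of_isThreeCycle {x y z : Fin 3 × ℕ} (h : IsThreeCycle (C3Of omega).E x y z) :
    y.2 = x.2 ∧ z.2 = x.2 := by
  have hxy := snd_le_of_edge h.1
  have hyz := snd_le_of_edge h.2.1
  have hzx := snd_le_of_edge h.2.2
  lia

/-- The first `p` positions of `C3Of omega`, those in `Y` with their whole 3-cycle and the others
with a single vertex. -/
def vertices (p : ℕ) (Y : Finset ℕ) : Finset (Fin 3 × ℕ) := {0} ×ˢ range p ∪ {1, 2} ×ˢ Y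

variable {p : ℕ} {Y Y' : Finset ℕ}

theorem mem_vertices {i : Fin 3} {x : ℕ} :
    (i, x) ∈ vertices p Y ↔ i = 0 ∧ x < p ∨ i ≠ 0 ∧ x ∈ Y := by
  have : i = 1 ∨ i = 2 ↔ i ≠ 0 := by decide +revert
  simp [vertices, this, eq_comm (a := (0 : Fin 3)), and_comm]

theorem card_vertices : #(vertices p Y) = p + 2 * #Y := by
  rw [vertices, card_union_of_disjoint, card_product, card_product]
  · simp
  · exact disjoint_product.2 (.inl (by decide))

theorem lt_of_mem_vertices (hY : Y ⊆ range p) {x : Fin 3 × ℕ} (hx : x ∈ vertices p Y) :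
    x.2 < p := by
  obtain ⟨-, h⟩ | ⟨-, h⟩ := mem_vertices.1 hx
  exacts [h, mem_range.1 (hY h)]

section Rigidity

variable {f : Fin 3 × ℕ → Fin 3 × ℕ} (hY : Y ⊆ range p) (hY' : Y' ⊆ range p)
  (hf : (C3Of omega).IsIsoOn f (vertices p Y) (vertices p Y'))

include hY hf

theorem snd_map_eq {i : Fin 3} {x : ℕ} (hx : (i, x) ∈ vertices p Y) :
    (f (i, x)).2 = (f (0, x)).2 := by
  obtain ⟨rfl, -⟩ | ⟨-, hxY⟩ := mem_vertices.1 hx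
  · rfl
  have mem (j : Fin 3) : (j, x) ∈ vertices p Y :=
    mem_vertices.2 (by have := mem_range.1 (hY hxY); tauto)
  have edge (j : Fin 3) : (C3Of omega).E (f (j, x)) (f (j + 1, x)) :=
    (hf.2 _ (mem j) _ (mem (j + 1))).2 (.inl ⟨rfl, rfl⟩)
  obtain ⟨h1, h2⟩ := snd_eq_of_isThreeCycle ⟨edge 0, edge 1, edge 2⟩
  fin_cases i
  exacts [rfl, h1, h2]

include hY'

theorem snd_map_zero_eq {x : ℕ} (hx : x < p) : (f (0, x)).2 = x := by
  have mem_zero (x : Fin p) : (0, x.1) ∈ vertices p Y := mem_vertices.2 (.inl ⟨rfl, x.2⟩)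
  let g (x : Fin p) : Fin p := ⟨(f (0, x)).2, lt_of_mem_vertices hY' (hf.1.mapsTo (mem_zero x))⟩
  have monotone : Monotone g := fun x y hxy => by
    obtain rfl | hxy := hxy.eq_or_lt
    · rfl
    · exact snd_le_of_edge ((hf.2 _ (mem_zero x) _ (mem_zero y)).2 (.inr hxy))
  have surjective : Function.Surjective g := fun y => by
    have hy : (0, y.1) ∈ vertices p Y' := mem_vertices.2 (.inl ⟨rfl, y.2⟩)
    obtain ⟨⟨i, x⟩, hx, h⟩ := hf.1.surjOn hy
    refine ⟨⟨x, lt_of_mem_vertices hY hx⟩, Fin.ext ?_⟩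
    exact (snd_map_eq hY hf hx).symm.trans (congrArg Prod.snd h)
  have strictMono : StrictMono g :=
    monotone.strictMono_of_injective (Finite.injective_iff_surjective.2 surjective)
  exact congrArg Fin.val (le_antisymm strictMono.apply_le (strictMono.le_apply (x := ⟨x, hx⟩)))

theorem subset_of_isIsoOn : Y ⊆ Y' := by
  intro y hy
  have mem (i : Fin 3) : (i, y) ∈ vertices p Y :=
    mem_vertices.2 (by have := mem_range.1 (hY hy); tauto)
  have snd_eq (i : Fin 3) : (f (i, y)).2 = y :=
    (snd_map_eq hY hf (mem i)).trans (snd_map_zero_eq hY hY' hf (mem_range.1 (hY hy)))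
  have mem_of_fst_ne_zero {i : Fin 3} (hi : (f (i, y)).1 ≠ 0) : y ∈ Y' := by
    obtain ⟨h, -⟩ | ⟨-, h⟩ := mem_vertices.1 (hf.1.mapsTo (mem i))
    · exact absurd h hi
    · rwa [snd_eq] at h
  by_contra hy'
  have fst_eq (i : Fin 3) : (f (i, y)).1 = 0 := not_not.1 fun hi => hy' (mem_of_fst_ne_zero hi)
  have h01 : f (0, y) = f (1, y) :=
    Prod.ext ((fst_eq 0).trans (fst_eq 1).symm) ((snd_eq 0).trans (snd_eq 1).symm)
  exact absurd (congrArg Prod.fst (hf.1.injOn (mem 0) (mem 1) h01)) zero_ne_one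

end Rigidity

theorem two_pow_le_mul_profile {m p : ℕ} (hp : 0 < p) (h : 2 * m ≤ p) :
    2 ^ m ≤ (p + 2 * m) * (C3Of omega).profile (p + 2 * m) := by
  have count := card_le_mul_profile (T := C3Of omega) ((0, 0) : Fin 3 × ℕ)
    (powersetCard m (range p)) (vertices p) (n := p + 2 * m)
    (fun _ _ => mem_vertices.2 (.inl ⟨rfl, hp⟩))
    (fun Y hY => by rw [← (mem_powersetCard.1 hY).2]; exact card_vertices)
    fun Y hY Y' hY' f hf _ => by
      rw [mem_powersetCard] at hY hY'
      exact eq_of_subset_of_card_le (subset_of_isIsoOn hY.1 hY'.1 hf)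
        (hY'.2.trans hY.2.symm).le
  rw [card_powersetCard, card_range] at count
  exact (two_pow_le_choose h).trans count

theorem two_pow_div_four_le_mul_profile {n : ℕ} (hn : 1 ≤ n) :
    2 ^ ((n - 1) / 4) ≤ n * (C3Of omega).profile n := by
  obtain ⟨p, hp, hp0, h⟩ : ∃ p, n = p + 2 * ((n - 1) / 4) ∧ 0 < p ∧ 2 * ((n - 1) / 4) ≤ p :=
    ⟨n - 2 * ((n - 1) / 4), by lia, by lia, by lia⟩
  simpa only [← hp] using two_pow_le_mul_profile hp0 h

end C3Of

section Patterns

/-- The small tournaments that separate the six ages. -/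
inductive Pattern
  | strongFour
  | dominatedCycle
  | twoCycles
  | regularFive
  | linkedArcs
  | crossedArcs
  | nestedArcs
  | fan

namespace Pattern

/-- The number of vertices of a pattern. -/
def size : Pattern → ℕ
  | strongFour | dominatedCycle => 4
  | twoCycles => 6
  | regularFive | linkedArcs | crossedArcs | nestedArcs | fan => 5

/-- The arcs of a pattern that go against the chain `0 → 1 → ⋯` of its vertices. -/
def backArcs : Pattern → Finset (ℕ × ℕ)
  | strongFour => {(3, 0)}
  | dominatedCycle => {(3, 1)}
  | twoCycles => {(2, 0), (5, 3)}
  | regularFive => {(3, 0), (4, 0), (4, 1)}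
  | linkedArcs => {(2, 0), (4, 1)}
  | crossedArcs => {(3, 0), (4, 1)}
  | nestedArcs => {(4, 0), (3, 1)}
  | fan => {(4, 0), (4, 1)}

/-- The edges of a pattern. -/
def Edge (P : Pattern) (i j : Fin P.size) : Prop :=
  i < j ∧ (j.1, i.1) ∉ P.backArcs ∨ j < i ∧ (i.1, j.1) ∈ P.backArcs

instance (P : Pattern) : DecidableRel P.Edge := fun _ _ =>
  inferInstanceAs (Decidable (_ ∧ _ ∨ _ ∧ _))

instance (P : Pattern) : Std.Trichotomous P.Edge where
  trichotomous i j h h' := by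
    simp only [Edge] at h h'
    by_contra hne
    rcases lt_or_gt_of_ne hne <;> tauto

theorem nonempty_relEmbedding_of_decide [DecidableRel T.E] {P : Pattern} (f : Fin P.size → T.V)
    (hf : decide (∀ i j, P.Edge i j → T.E (f i) (f j))) : Nonempty (P.Edge ↪r T.E) :=
  ⟨.ofMonotone f (of_decide_eq_true hf)⟩

end Pattern

theorem nonempty_relEmbedding_of_age_subset {α : Type*} [Finite α] {r : α → α → Prop}
    (h : T.age ⊆ T'.age) (f : r ↪r T.E) : Nonempty (r ↪r T'.E) := by
  have finite_range := Set.finite_range f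
  obtain ⟨g⟩ := age_subset_age_iff.1 h finite_range.toFinset
  refine ⟨RelEmbedding.trans ⟨⟨fun i => ⟨f i, by simp⟩, fun i j hij => ?_⟩, f.map_rel_iff⟩ g⟩
  exact f.injective (congrArg Subtype.val hij)

instance (n : ℕ) : OfNat C3.V n := inferInstanceAs (OfNat (Fin 3) n)

instance (n : ℕ) : OfNat omega.V n := inferInstanceAs (OfNat ℕ n)

instance : DecidableEq omega.V := inferInstanceAs (DecidableEq ℕ)

instance : DecidableRel omega.E := inferInstanceAs (DecidableRel (· < · : ℕ → ℕ → Prop))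

instance : DecidableRel (C3Of omega).E := fun _ _ => decidable_of_iff' _ C3Of.edge_iff

instance [DecidableEq C.V] [DecidableRel C.E] : DecidableRel (VRel C)
  | some (x, i), some (y, j) => inferInstanceAs (Decidable (C.E x y ∨ x = y ∧ i < j))
  | none, some (_, j) => inferInstanceAs (Decidable (j = 0))
  | some (_, i), none => inferInstanceAs (Decidable (i = 1))
  | none, none => instDecidableFalse

instance [DecidableEq C.V] [DecidableRel C.E] (X : Finset Arc) :
    DecidableRel (DeltaRel C X) := fun _ _ =>
  inferInstanceAs (Decidable (_ ∧ _ ∨ _ ∧ _ ∨ _ ∧ _))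

/-- The six constructions. -/
inductive Construction
  | c3 | v | t | u | h | k
  deriving DecidableEq

namespace Construction

/-- The tournament that a construction builds from `C`. -/
def build : Construction → Tournament → Tournament
  | c3 => C3Of
  | v => VOf
  | t => TOf
  | u => UOf
  | h => HOf
  | k => KOf

instance : (F : Construction) → DecidableRel (F.build omega).E
  | c3 => inferInstanceAs (DecidableRel (C3Of omega).E)
  | v => inferInstanceAs (DecidableRel (VRel omega))
  | t | u | h | k => inferInstanceAs (DecidableRel (DeltaRel omega _))

/-- Patterns that occur in the tournaments built by a construction. -/
def present : Construction → Set Pattern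
  | c3 => {.dominatedCycle, .twoCycles}
  | v => {.strongFour, .dominatedCycle, .linkedArcs, .fan}
  | t => {.strongFour, .regularFive, .fan}
  | u => {.strongFour, .dominatedCycle, .crossedArcs, .fan}
  | h => {.strongFour, .dominatedCycle, .linkedArcs, .crossedArcs}
  | k => {.strongFour, .dominatedCycle, .nestedArcs}

/-- Patterns that do not occur in the tournaments built by a construction. -/
def absent : Construction → Set Pattern
  | c3 => {.strongFour}
  | v => {.twoCycles, .regularFive, .crossedArcs, .nestedArcs}
  | t => {.dominatedCycle}
  | u => {.twoCycles, .regularFive, .linkedArcs, .nestedArcs}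
  | h => {.twoCycles, .nestedArcs, .fan}
  | k => {.twoCycles, .crossedArcs, .fan}

theorem exists_mem_present_mem_absent {F G : Construction} (h : F ≠ G) :
    ∃ P ∈ F.present, P ∈ G.absent := by
  cases F <;> cases G <;> first | exact absurd rfl h | simp [present, absent]

open Pattern in
theorem nonempty_relEmbedding_of_mem_present {F : Construction} {P : Pattern}
    (hP : P ∈ F.present) : Nonempty (P.Edge ↪r (F.build omega).E) := by
  cases F with
  | c3 =>
    obtain rfl | rfl := hP
    · exact nonempty_relEmbedding_of_decide ![(0, 0), (0, 1), (1, 1), (2, 1)] rfl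
    · exact nonempty_relEmbedding_of_decide
        ![(0, 0), (1, 0), (2, 0), (0, 1), (1, 1), (2, 1)] rfl
  | v =>
    obtain rfl | rfl | rfl | rfl := hP
    · exact nonempty_relEmbedding_of_decide ![some (0, 0), some (0, 1), some (1, 1), none] rfl
    · exact nonempty_relEmbedding_of_decide ![some (0, 1), some (1, 0), some (1, 1), none] rfl
    · exact nonempty_relEmbedding_of_decide
        ![some (0, 1), none, some (0, 0), some (1, 0), some (1, 1)] rfl
    · exact nonempty_relEmbedding_of_decide
        ![some (0, 0), some (1, 0), some (1, 1), some (2, 1), none] rfl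
  | t =>
    obtain rfl | rfl | rfl := hP
    · exact nonempty_relEmbedding_of_decide ![(0, 0), (1, 0), (0, 1), (1, 1)] rfl
    · exact nonempty_relEmbedding_of_decide ![(0, 0), (1, 0), (0, 1), (1, 1), (2, 1)] rfl
    · exact nonempty_relEmbedding_of_decide ![(0, 0), (1, 0), (2, 0), (0, 1), (2, 1)] rfl
  | u =>
    obtain rfl | rfl | rfl | rfl := hP
    · exact nonempty_relEmbedding_of_decide ![(0, 1), (1, 0), (2, 0), (2, 1)] rfl
    · exact nonempty_relEmbedding_of_decide ![(0, 0), (0, 1), (1, 0), (1, 1)] rfl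
    · exact nonempty_relEmbedding_of_decide ![(1, 0), (2, 1), (1, 1), (0, 1), (2, 0)] rfl
    · exact nonempty_relEmbedding_of_decide ![(1, 0), (2, 0), (3, 1), (2, 1), (0, 1)] rfl
  | h =>
    obtain rfl | rfl | rfl | rfl := hP
    · exact nonempty_relEmbedding_of_decide ![(0, 0), (0, 1), (1, 0), (1, 1)] rfl
    · exact nonempty_relEmbedding_of_decide ![(0, 1), (1, 0), (1, 1), (2, 1)] rfl
    · exact nonempty_relEmbedding_of_decide ![(0, 1), (2, 1), (0, 0), (1, 0), (2, 0)] rfl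
    · exact nonempty_relEmbedding_of_decide ![(0, 1), (1, 1), (2, 1), (0, 0), (1, 0)] rfl
  | k =>
    obtain rfl | rfl | rfl := hP
    · exact nonempty_relEmbedding_of_decide ![(1, 1), (0, 0), (0, 1), (1, 0)] rfl
    · exact nonempty_relEmbedding_of_decide ![(2, 1), (0, 0), (1, 0), (1, 1)] rfl
    · exact nonempty_relEmbedding_of_decide ![(2, 1), (0, 0), (1, 0), (1, 1), (2, 0)] rfl

end Construction

end Patterns

section Obstructions

variable {α : Type*} {r : α → α → Prop}

theorem C3Of.eq_of_isThreeCycle {w x y z : Fin 3 × ℕ} (hy : IsThreeCycle (C3Of omega).E w x y)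
    (hz : IsThreeCycle (C3Of omega).E w x z) : y = z := by
  obtain ⟨hx, hyw⟩ := snd_eq_of_isThreeCycle hy
  obtain ⟨-, hzw⟩ := snd_eq_of_isThreeCycle hz
  have fst_eq {x y : Fin 3 × ℕ} (h : (C3Of omega).E x y) (hxy : y.2 = x.2) : y.1 = x.1 + 1 :=
    ((edge_iff.1 h).resolve_right hxy.not_gt).2
  exact Prod.ext ((fst_eq hy.2.1 (hyw.trans hx.symm)).trans
    (fst_eq hz.2.1 (hzw.trans hx.symm)).symm) (hyw.trans hzw.symm)

theorem VOf.eq_none_of_isThreeCycle {x y z : Option (ℕ × Fin 2)}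
    (h : IsThreeCycle (VOf omega).E x y z) : x = none ∨ y = none ∨ z = none := by
  have lex {p q : ℕ × Fin 2} (h : (VOf omega).E (some p) (some q)) : toLex p < toLex q :=
    Prod.Lex.lt_iff.2 h
  obtain _ | p := x
  · simp
  obtain _ | q := y
  · simp
  obtain _ | s := z
  · simp
  exact absurd (((lex h.1).trans (lex h.2.1)).trans (lex h.2.2)) (lt_irrefl _)

theorem VOf.exists_forall_isThreeCycle [Nonempty α] (f : r ↪r (VOf omega).E) :
    ∃ v, ∀ x y z, IsThreeCycle r x y z → v = x ∨ v = y ∨ v = z := by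
  by_cases h : ∃ v, f v = none
  · obtain ⟨v, hv⟩ := h
    have eq_of_map_eq_none {x : α} (hx : f x = none) : v = x := f.injective (hv.trans hx.symm)
    exact ⟨v, fun x y z hxyz => (eq_none_of_isThreeCycle (hxyz.map f)).imp eq_of_map_eq_none
      (.imp eq_of_map_eq_none eq_of_map_eq_none)⟩
  · refine ⟨Classical.arbitrary α, fun x y z hxyz => absurd ?_ h⟩
    obtain h | h | h := eq_none_of_isThreeCycle (hxyz.map f)
    exacts [⟨x, h⟩, ⟨y, h⟩, ⟨z, h⟩]

/-- The edges from colour `0` to colour `1`. In `HOf omega` and `KOf omega`, where the colour is the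
second coordinate, they are the edges `(x, 0) → (x, 1)`. -/
def IsRung (r : α → α → Prop) (c : α → Fin 2) (x y : α) : Prop := c x = 0 ∧ c y = 1 ∧ r x y

instance [DecidableRel r] (c : α → Fin 2) (x y : α) : Decidable (IsRung r c x y) :=
  inferInstanceAs (Decidable (_ ∧ _))

theorem IsRung.map {β : Type*} {s : β → β → Prop} {c : β → Fin 2} {x y : α} (f : r ↪r s)
    (h : IsRung r (c ∘ f) x y) : IsRung s c (f x) (f y) :=
  ⟨h.1, h.2.1, f.map_rel_iff.2 h.2.2⟩

section Edges

variable {w x y z : ℕ × Fin 2}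

theorem TOf.edge_iff : (TOf omega).E x y ↔
    x.2 = y.2 ∧ x.1 < y.1 ∨ x.2 < y.2 ∧ y.1 ≤ x.1 ∨ y.2 < x.2 ∧ y.1 < x.1 := by
  obtain ⟨⟨x, i⟩, ⟨y, j⟩⟩ := x, y
  fin_cases i <;> fin_cases j <;>
    simp [TOf, Delta, DeltaRel, omega, hArc, vArc, dArc, le_iff_eq_or_lt, eq_comm (a := x)]

theorem UOf.edge_iff : (UOf omega).E x y ↔
    x.2 = 0 ∧ y.2 = 0 ∧ x.1 < y.1 ∨ x.2 = 1 ∧ y.2 = 1 ∧ y.1 < x.1 ∨ x.2 < y.2 ∧ x.1 ≤ y.1 ∨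
      y.2 < x.2 ∧ x.1 < y.1 := by
  obtain ⟨⟨x, i⟩, ⟨y, j⟩⟩ := x, y
  fin_cases i <;> fin_cases j <;>
    simp [UOf, Delta, DeltaRel, omega, hArc, vArc, dArc, le_iff_eq_or_lt]

theorem HOf.edge_iff : (HOf omega).E x y ↔
    x.2 = y.2 ∧ x.1 < y.1 ∨ x.2 < y.2 ∧ x.1 = y.1 ∨ y.2 < x.2 ∧ x.1 ≠ y.1 := by
  obtain ⟨⟨x, i⟩, ⟨y, j⟩⟩ := x, y
  fin_cases i <;> fin_cases j <;> simp [HOf, Delta, DeltaRel, omega, hArc, vArc, dArc]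

theorem KOf.edge_iff : (KOf omega).E x y ↔
    x.2 = 0 ∧ y.2 = 0 ∧ x.1 < y.1 ∨ x.2 = 1 ∧ y.2 = 1 ∧ y.1 < x.1 ∨ x.2 < y.2 ∧ x.1 = y.1 ∨
      y.2 < x.2 ∧ x.1 ≠ y.1 := by
  obtain ⟨⟨x, i⟩, ⟨y, j⟩⟩ := x, y
  fin_cases i <;> fin_cases j <;> simp [KOf, Delta, DeltaRel, omega, hArc, vArc, dArc]

theorem TOf.not_dominates_isThreeCycle (h : IsThreeCycle (TOf omega).E x y z) :
    ¬ ((TOf omega).E w x ∧ (TOf omega).E w y ∧ (TOf omega).E w z) := by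
  simp only [IsThreeCycle, TOf.edge_iff] at h ⊢
  lia

theorem UOf.sum_snd_of_isThreeCycle (h : IsThreeCycle (UOf omega).E x y z) :
    (x.2 + y.2 + z.2 : ℕ) = 2 := by
  simp only [IsThreeCycle, UOf.edge_iff] at h
  lia

theorem UOf.edge_of_snd (hx : x.2 = 1) (hy : y.2 = 0) (hz : z.2 = 1) (hxy : (UOf omega).E x y)
    (hyz : (UOf omega).E y z) : (UOf omega).E z x := by
  simp only [UOf.edge_iff] at *
  lia

theorem HOf.not_monochromatic_of_isThreeCycle (h : IsThreeCycle (HOf omega).E x y z) :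
    ¬ (x.2 = y.2 ∧ y.2 = z.2) := by
  simp only [IsThreeCycle, HOf.edge_iff] at h
  lia

theorem HOf.edge_iff_of_isRung {x' y' : ℕ × Fin 2} (h : IsRung (HOf omega).E Prod.snd x y)
    (h' : IsRung (HOf omega).E Prod.snd x' y') : (HOf omega).E x x' ↔ (HOf omega).E y y' := by
  simp only [IsRung, HOf.edge_iff] at *
  lia

theorem KOf.not_monochromatic_of_isThreeCycle (h : IsThreeCycle (KOf omega).E x y z) :
    ¬ (x.2 = y.2 ∧ y.2 = z.2) := by
  simp only [IsThreeCycle, KOf.edge_iff] at h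
  lia

theorem KOf.edge_iff_of_isRung {x' y' : ℕ × Fin 2} (h : IsRung (KOf omega).E Prod.snd x y)
    (h' : IsRung (KOf omega).E Prod.snd x' y') : (KOf omega).E x x' ↔ (KOf omega).E y' y := by
  obtain ⟨hx, hy, hxy⟩ := h
  obtain ⟨hx', hy', hxy'⟩ := h'
  have fst_eq : x.1 = y.1 := by simpa [KOf.edge_iff, hx, hy] using hxy
  have fst_eq' : x'.1 = y'.1 := by simpa [KOf.edge_iff, hx', hy'] using hxy'
  simp [KOf.edge_iff, hx, hx', hy, hy', fst_eq, fst_eq']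

end Edges

theorem UOf.exists_colouring (f : r ↪r (UOf omega).E) : ∃ c : α → Fin 2,
    (∀ x y z, IsThreeCycle r x y z → (c x + c y + c z : ℕ) = 2) ∧
    ∀ x y, c x = 1 ∧ c y = 0 ∧ r x y → ∀ z, c z = 1 ∧ r y z → r z x :=
  ⟨fun x => (f x).2, fun _ _ _ h => sum_snd_of_isThreeCycle (h.map f),
    fun _ _ ⟨hx, hy, hxy⟩ _ ⟨hz, hyz⟩ => f.map_rel_iff.1
      (edge_of_snd hx hy hz (f.map_rel_iff.2 hxy) (f.map_rel_iff.2 hyz))⟩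

theorem HOf.exists_colouring (f : r ↪r (HOf omega).E) : ∃ c : α → Fin 2,
    (∀ x y z, IsThreeCycle r x y z → ¬ (c x = c y ∧ c y = c z)) ∧
    ∀ x y, IsRung r c x y → ∀ x' y', IsRung r c x' y' → (r x x' ↔ r y y') :=
  ⟨Prod.snd ∘ f, fun _ _ _ h => not_monochromatic_of_isThreeCycle (h.map f),
    fun _ _ h _ _ h' => f.map_rel_iff.symm.trans <|
      (edge_iff_of_isRung (h.map f) (h'.map f)).trans f.map_rel_iff⟩

theorem KOf.exists_colouring (f : r ↪r (KOf omega).E) : ∃ c : α → Fin 2,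
    (∀ x y z, IsThreeCycle r x y z → ¬ (c x = c y ∧ c y = c z)) ∧
    ∀ x y, IsRung r c x y → ∀ x' y', IsRung r c x' y' → (r x x' ↔ r y' y) :=
  ⟨Prod.snd ∘ f, fun _ _ _ h => not_monochromatic_of_isThreeCycle (h.map f),
    fun _ _ h _ _ h' => f.map_rel_iff.symm.trans <|
      (edge_iff_of_isRung (h.map f) (h'.map f)).trans f.map_rel_iff⟩

end Obstructions

section Absence

open Construction Pattern

variable {P : Pattern}

theorem C3Of.isEmpty_relEmbedding (hP : P ∈ c3.absent) : IsEmpty (P.Edge ↪r (C3Of omega).E) := by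
  obtain rfl := hP
  refine ⟨fun f => ?_⟩
  obtain ⟨w, x, y, z, hyz, hy, hz⟩ : ∃ w x y z, y ≠ z ∧ IsThreeCycle strongFour.Edge w x y ∧
      IsThreeCycle strongFour.Edge w x z := by decide
  exact hyz (f.injective (eq_of_isThreeCycle (hy.map f) (hz.map f)))

theorem VOf.isEmpty_relEmbedding (hP : P ∈ v.absent) : IsEmpty (P.Edge ↪r (VOf omega).E) := by
  have : Nonempty (Fin P.size) := ⟨⟨0, by cases P <;> decide⟩⟩
  refine ⟨fun f => ?_⟩
  have := exists_forall_isThreeCycle f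
  obtain rfl | rfl | rfl | rfl := hP <;> revert this <;> decide

theorem TOf.isEmpty_relEmbedding (hP : P ∈ t.absent) : IsEmpty (P.Edge ↪r (TOf omega).E) := by
  obtain rfl := hP
  refine ⟨fun f => ?_⟩
  obtain ⟨w, x, y, z, cycle, hx, hy, hz⟩ : ∃ w x y z, IsThreeCycle dominatedCycle.Edge x y z ∧
      dominatedCycle.Edge w x ∧ dominatedCycle.Edge w y ∧ dominatedCycle.Edge w z := by decide
  exact not_dominates_isThreeCycle (cycle.map f)
    ⟨f.map_rel_iff.2 hx, f.map_rel_iff.2 hy, f.map_rel_iff.2 hz⟩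

theorem UOf.isEmpty_relEmbedding (hP : P ∈ u.absent) : IsEmpty (P.Edge ↪r (UOf omega).E) := by
  refine ⟨fun f => ?_⟩
  have := exists_colouring f
  obtain rfl | rfl | rfl | rfl := hP <;> revert this <;> decide

theorem HOf.isEmpty_relEmbedding (hP : P ∈ h.absent) : IsEmpty (P.Edge ↪r (HOf omega).E) := by
  refine ⟨fun f => ?_⟩
  have := exists_colouring f
  obtain rfl | rfl | rfl := hP <;> revert this <;> decide

theorem KOf.isEmpty_relEmbedding (hP : P ∈ k.absent) : IsEmpty (P.Edge ↪r (KOf omega).E) := by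
  refine ⟨fun f => ?_⟩
  have := exists_colouring f
  obtain rfl | rfl | rfl := hP <;> revert this <;> decide +kernel

end Absence

section Ages

set_option synthInstance.maxSize 256 in
instance (X : Finset Arc) : Decidable (Good X) := inferInstanceAs (Decidable (_ ∧ _ ∧ _ ∧ _))

namespace Construction

theorem isEmpty_relEmbedding_of_mem_absent {F : Construction} {P : Pattern} (hP : P ∈ F.absent) :
    IsEmpty (P.Edge ↪r (F.build omega).E) := by
  cases F
  exacts [C3Of.isEmpty_relEmbedding hP, VOf.isEmpty_relEmbedding hP, TOf.isEmpty_relEmbedding hP,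
    UOf.isEmpty_relEmbedding hP, HOf.isEmpty_relEmbedding hP, KOf.isEmpty_relEmbedding hP]

theorem not_age_build_omega_subset {F G : Construction} (h : F ≠ G) :
    ¬ (F.build omega).age ⊆ (G.build omega).age := fun hsub => by
  obtain ⟨P, hF, hG⟩ := exists_mem_present_mem_absent h
  obtain ⟨f⟩ := nonempty_relEmbedding_of_mem_present hF
  obtain ⟨g⟩ := nonempty_relEmbedding_of_age_subset hsub f
  exact (isEmpty_relEmbedding_of_mem_absent hG).false g

theorem age_build_omega_injective :
    Function.Injective fun F : Construction => (F.build omega).age :=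
  fun _ _ h => not_not.1 fun hne => not_age_build_omega_subset hne (Eq.subset h)

theorem age_build_mono (F : Construction) (hC : C.age ⊆ C'.age) :
    (F.build C).age ⊆ (F.build C').age := by
  cases F with
  | c3 => exact age_lexProd_mono C3 hC
  | v => exact age_VOf_mono hC
  | t | u | h | k => exact age_Delta_mono _ (by decide) hC

theorem age_build_omega_dual (F : Construction) :
    (F.build omega.dual).age = (F.build omega).age :=
  (F.age_build_mono age_omega_dual.subset).antisymm (F.age_build_mono age_omega_dual.superset)

theorem two_pow_div_four_le_mul_profile (F : Construction) {n : ℕ} (hn : 1 ≤ n) :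
    2 ^ ((n - 1) / 4) ≤ n * (F.build omega).profile n := by
  cases F with
  | c3 => exact C3Of.two_pow_div_four_le_mul_profile hn
  | v => exact VOf.pivotedChain.two_pow_div_four_le_mul_profile hn
  | t | h | k =>
    exact (Delta.pivotedChain (by decide) 0 (by decide)).two_pow_div_four_le_mul_profile hn
  | u => exact (Delta.pivotedChain (by decide) 1 (by decide)).two_pow_div_four_le_mul_profile hn

theorem mem_frakBOf_iff : T ∈ frakBOf C ↔ ∃ F : Construction, F.build C = T := by
  constructor
  · rintro (rfl | rfl | rfl | rfl | rfl | rfl)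
    exacts [⟨c3, rfl⟩, ⟨v, rfl⟩, ⟨t, rfl⟩, ⟨u, rfl⟩, ⟨h, rfl⟩, ⟨k, rfl⟩]
  · rintro ⟨F, rfl⟩
    cases F <;> simp [frakBOf, build]

theorem age_image_frakB : age '' frakB = Set.range fun F : Construction => (F.build omega).age := by
  ext a
  simp only [frakB, Set.mem_image, Set.mem_union, mem_frakBOf_iff, Set.mem_range]
  constructor
  · rintro ⟨_, ⟨F, rfl⟩ | ⟨F, rfl⟩, rfl⟩
    exacts [⟨F, rfl⟩, ⟨F, F.age_build_omega_dual.symm⟩]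
  · rintro ⟨F, rfl⟩
    exact ⟨_, .inl ⟨F, rfl⟩, rfl⟩

instance : Fintype Construction where
  elems := {c3, v, t, u, h, k}
  complete F := by cases F <;> decide

end Construction

end Ages

end Tournament

theorem lemma4 :
    (Tournament.age '' Tournament.frakB).ncard = 6 ∧
    IsAntichain (fun 𝒜 𝒜' : Set Tournament.IsoType => 𝒜 ⊆ 𝒜')
      (Tournament.age '' Tournament.frakB) ∧
    ∀ T ∈ Tournament.frakB, ∃ a c : ℝ, 0 < a ∧ 1 < c ∧
      ∀ n : ℕ, a * c ^ n ≤ (T.profile n : ℝ) := by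
  rw [Tournament.Construction.age_image_frakB]
  refine ⟨?_, ?_, fun T hT => ?_⟩
  · exact (Nat.card_range_of_injective Tournament.Construction.age_build_omega_injective).trans
      Nat.card_eq_fintype_card
  · rintro _ ⟨F, rfl⟩ _ ⟨G, rfl⟩ hne
    exact Tournament.Construction.not_age_build_omega_subset fun h => hne (h ▸ rfl)
  · obtain ⟨F, hF⟩ : ∃ F : Tournament.Construction, (F.build Tournament.omega).age = T.age :=
      Tournament.Construction.age_image_frakB.subset ⟨T, hT, rfl⟩
    obtain ⟨a, c, ha, hc, bound⟩ := Tournament.exists_exponential_lower_bound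
      (F.build Tournament.omega).one_le_profile_zero fun _ => F.two_pow_div_four_le_mul_profile
    refine ⟨a, c, ha, hc, fun n => (bound n).trans ?_⟩
    exact_mod_cast Tournament.profile_mono hF.subset n
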